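/- Let $\mathcal P_2(\mathbb R^2)$ be the set of Borel probability measures on $\mathbb R^2$ with finite second moment, let $W_2$ be the 2-Wasserstein distance for the Euclidean norm, and let $\nu_0=\delta_{(0,0)}$, $\nu_1=\tfrac12(\delta_{(-1,-1)}+\delta_{(1,1)})$, $\nu_2=\tfrac12(\delta_{(1,-1)}+\delta_{(-1,1)})$. Consider on $\mathcal P_2(\mathbb R^2)$ the functional $$\mathscr E(\mu)=-W_2^2(\mu,\nu_0)+W_2^2(\mu,\nu_1)+W_2^2(\mu,\nu_2).$$ Then $\mathscr E$ has a minimizer in $\mathcal P_2(\mathbb R^2)$, but the minimizer is not unique. Moreover, let $S(x,y)=(-y,-x)$ if $|y|>|x|$ and $S(x,y)=(x,y)$ otherwise, and let $T(x,y)=(y,x)$ if $|x|>|y|$ and $T(x,y)=(x,y)$ otherwise. Every $\mu\in\mathcal P_2(\mathbb R^2)$ with $S_\sharp\mu=\mu$ and $T_\sharp\mu=\mu$ (in particular, every minimizer with this symmetry) satisfies $\operatorname{supp}\mu\subset\{|x|=|y|\}$. Every $\mu\in\mathcal P_2(\mathbb R^2)$ with $\operatorname{supp}\mu\subset\{|x|=|y|\}$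 satisfies $\mathscr E(\mu)\ge 2$. On the other hand, $\eta=\tfrac12(\delta_{(0,1)}+\delta_{(0,-1)})\in\mathcal P_2(\mathbb R^2)$ has $\mathscr E(\eta)=1$. -/

import Mathlib

open MeasureTheory Set
open scoped ENNReal

noncomputable section

namespace SignedBarycenter

/-- The Borel probability measures on `H` with finite second moment. -/
def P2 (H : Type*) [NormedAddCommGroup H] [MeasurableSpace H] : Set (Measure H) :=
  {μ | IsProbabilityMeasure μ ∧ ∫⁻ x, ‖x‖ₑ ^ 2 ∂μ < ∞}

/-- The admissible transport plans between `μ` and `ν`. -/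
def transportPlans {H : Type*} [MeasurableSpace H] (μ ν : Measure H) : Set (Measure (H × H)) :=
  {γ | IsProbabilityMeasure γ ∧ γ.map Prod.fst = μ ∧ γ.map Prod.snd = ν}

/-- The Wasserstein distance of order two. The infimum is taken in `[0, ∞]`; it is finite for
`μ` and `ν` in `P2 H`. -/
def W2 {H : Type*} [NormedAddCommGroup H] [MeasurableSpace H] (μ ν : Measure H) : ℝ :=
  (⨅ γ ∈ transportPlans μ ν, (∫⁻ z, ‖z.1 - z.2‖ₑ ^ 2 ∂γ) ^ (1 / 2 : ℝ)).toReal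

/-- The Euclidean plane. -/
abbrev Plane : Type := EuclideanSpace ℝ (Fin 2)

/-- The measure `(δ_p + δ_q) / 2`. -/
def halfDirac (p q : Plane) : Measure Plane :=
  (2⁻¹ : ℝ≥0∞) • (Measure.dirac p + Measure.dirac q)

def ν₀ : Measure Plane := Measure.dirac !₂[0, 0]

def ν₁ : Measure Plane := halfDirac !₂[-1, -1] !₂[1, 1]

def ν₂ : Measure Plane := halfDirac !₂[1, -1] !₂[-1, 1]

def η : Measure Plane := halfDirac !₂[0, 1] !₂[0, -1]

/-- The functional `-W₂²(μ, ν₀) + W₂²(μ, ν₁) + W₂²(μ, ν₂)`, considered for `μ ∈ P2 Plane`. -/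
def energy (μ : Measure Plane) : ℝ :=
  -W2 μ ν₀ ^ 2 + W2 μ ν₁ ^ 2 + W2 μ ν₂ ^ 2

/-- `μ` minimizes the functional over the probability measures with finite second moment. -/
def IsMinimizer (μ : Measure Plane) : Prop :=
  μ ∈ P2 Plane ∧ ∀ ρ ∈ P2 Plane, energy μ ≤ energy ρ

/-- The reflection `(x, y) ↦ (-y, -x)` on `{|y| > |x|}`, the identity elsewhere. -/
def foldS (p : Plane) : Plane := if |p 0| < |p 1| then !₂[-p 1, -p 0] else p

/-- The reflection `(x, y) ↦ (y, x)` on `{|x| > |y|}`, the identity elsewhere. -/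
def foldT (p : Plane) : Plane := if |p 1| < |p 0| then !₂[p 1, p 0] else p

/-- The union of the two diagonals of the plane. -/
def diagonals : Set Plane := {p | |p 0| = |p 1|}

/-- The map `foldS` is measurable, so that `Measure.map foldS μ` is the push-forward. -/
theorem measurable_foldS : Measurable foldS := by
  unfold foldS
  refine Measurable.ite (measurableSet_lt (by fun_prop) (by fun_prop)) ?_ measurable_id
  exact Continuous.measurable (by fun_prop)

/-- The map `foldT` is measurable, so that `Measure.map foldT μ` is the push-forward. -/
theorem measurable_foldT : Measurable foldT := by
  unfold foldT
  refine Measurable.ite (measurableSet_lt (by fun_prop) (by fun_prop)) ?_ measurable_id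
  exact Continuous.measurable (by fun_prop)

end SignedBarycenter

end

namespace SignedBarycenter

/-! ### Bounds on the Wasserstein distance from plans. -/

section Transport

variable {H : Type*} [NormedAddCommGroup H] [MeasurableSpace H]

/-! Sending each point to its nearest atom bounds the two positive terms from below, and sending all
mass to the origin bounds the subtracted one from above. So the energy is at least the integral of
`energyDensity` (`le_energy`), which equals `(M - 2)² + m²` with `M`, `m` the larger and smaller of
`|x|`, `|y|`. It is nonnegative, and on the diagonals it is `2(|x| - 1)² + 2`. Symmetric pairs on an
axis at distance `s` from the origin have energy `(s - 2)²`: `s = 2` on either axis gives two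
minimizers, `s = 1` gives `η`. -/

theorem W2_nonneg (μ ν : Measure H) : 0 ≤ W2 μ ν := ENNReal.toReal_nonneg

theorem rpow_half_toReal_sq (c : ℝ≥0∞) : (c ^ (1 / 2 : ℝ)).toReal ^ 2 = c.toReal := by
  rw [← ENNReal.toReal_pow, ← ENNReal.rpow_natCast, ← ENNReal.rpow_mul]
  norm_num

/-- The cost of a plan bounds the squared distance from above. -/
theorem W2_sq_le {μ ν : Measure H} {γ : Measure (H × H)} (hγ : γ ∈ transportPlans μ ν)
    (hfin : ∫⁻ z, ‖z.1 - z.2‖ₑ ^ 2 ∂γ ≠ ∞) :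
    W2 μ ν ^ 2 ≤ (∫⁻ z, ‖z.1 - z.2‖ₑ ^ 2 ∂γ).toReal := by
  rw [← rpow_half_toReal_sq]
  refine pow_le_pow_left₀ (W2_nonneg μ ν) ?_ 2
  exact ENNReal.toReal_mono (ENNReal.rpow_ne_top_of_nonneg (by norm_num) hfin) (iInf₂_le γ hγ)

/-- A common lower bound of the costs of all plans bounds the squared distance from below. -/
theorem le_W2_sq {μ ν : Measure H} {γ : Measure (H × H)} (hγ : γ ∈ transportPlans μ ν)
    (hfin : ∫⁻ z, ‖z.1 - z.2‖ₑ ^ 2 ∂γ ≠ ∞) {c : ℝ≥0∞}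
    (hc : ∀ γ ∈ transportPlans μ ν, c ≤ ∫⁻ z, ‖z.1 - z.2‖ₑ ^ 2 ∂γ) :
    c.toReal ≤ W2 μ ν ^ 2 := by
  rw [← rpow_half_toReal_sq]
  refine pow_le_pow_left₀ ENNReal.toReal_nonneg ?_ 2
  refine ENNReal.toReal_mono ?_ (le_iInf₂ fun γ' h => ENNReal.rpow_le_rpow (hc γ' h) (by norm_num))
  exact ne_top_of_le_ne_top (ENNReal.rpow_ne_top_of_nonneg (by norm_num) hfin) (iInf₂_le γ hγ)

end Transport

/-! ### Transport to one or two atoms. -/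

theorem isProbabilityMeasure_half_add {α : Type*} [MeasurableSpace α] (μ ν : Measure α)
    [IsProbabilityMeasure μ] [IsProbabilityMeasure ν] :
    IsProbabilityMeasure ((2⁻¹ : ℝ≥0∞) • (μ + ν)) := by
  constructor
  simp only [Measure.smul_apply, Measure.add_apply, measure_univ, smul_eq_mul, one_add_one_eq_two]
  exact ENNReal.inv_mul_cancel (by norm_num) (by norm_num)

instance (p q : Plane) : IsProbabilityMeasure (halfDirac p q) :=
  isProbabilityMeasure_half_add _ _

theorem lintegral_halfDirac (p q : Plane) (f : Plane → ℝ≥0∞) :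
    ∫⁻ x, f x ∂halfDirac p q = 2⁻¹ * (f p + f q) := by
  simp [halfDirac, lintegral_add_measure, mul_add]

theorem integral_halfDirac (p q : Plane) (f : Plane → ℝ) :
    ∫ x, f x ∂halfDirac p q = 2⁻¹ * (f p + f q) := by
  rw [halfDirac, integral_smul_measure, integral_add_measure]
  · simp
  all_goals exact integrable_dirac enorm_lt_top

theorem halfDirac_self (p : Plane) : halfDirac p p = Measure.dirac p := by
  rw [halfDirac, ← two_smul ℝ≥0∞, smul_smul, ENNReal.inv_mul_cancel (by norm_num) (by norm_num),
    one_smul]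

theorem halfDirac_mem_P2 (p q : Plane) : halfDirac p q ∈ P2 Plane := by
  refine ⟨inferInstance, ?_⟩
  rw [lintegral_halfDirac]
  exact ENNReal.mul_lt_top (by norm_num)
    (ENNReal.add_lt_top.2 ⟨ENNReal.pow_lt_top enorm_lt_top, ENNReal.pow_lt_top enorm_lt_top⟩)

theorem enorm_sq_eq (x : Plane) : ‖x‖ₑ ^ 2 = ENNReal.ofReal (‖x‖ ^ 2) := by
  rw [← ofReal_norm, ENNReal.ofReal_pow (norm_nonneg _)]

theorem integrable_norm_sub_sq {μ : Measure Plane} (hμ : μ ∈ P2 Plane) (a : Plane) :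
    Integrable (fun x => ‖x - a‖ ^ 2) μ := by
  have := hμ.1
  have h : MemLp (fun x : Plane => x) 2 μ := by
    rw [memLp_two_iff_integrable_sq_norm (by fun_prop)]
    refine ⟨by fun_prop, ?_⟩
    simpa [hasFiniteIntegral_iff_enorm, enorm_pow] using hμ.2
  exact (memLp_two_iff_integrable_sq_norm (by fun_prop)).1 (h.sub (memLp_const a))

theorem lintegral_enorm_sub_sq {μ : Measure Plane} (hμ : μ ∈ P2 Plane) (a : Plane) :
    ∫⁻ x, ‖x - a‖ₑ ^ 2 ∂μ = ENNReal.ofReal (∫ x, ‖x - a‖ ^ 2 ∂μ) := by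
  simp_rw [enorm_sq_eq]
  exact (ofReal_integral_eq_lintegral_ofReal (integrable_norm_sub_sq hμ a)
    (ae_of_all _ fun x => by positivity)).symm

/-- The plan that splits the mass of `μ` evenly between `a` and `b`. -/
noncomputable def evenPlan (μ : Measure Plane) (a b : Plane) : Measure (Plane × Plane) :=
  (2⁻¹ : ℝ≥0∞) • (μ.map (fun x => (x, a)) + μ.map (fun x => (x, b)))

theorem evenPlan_mem (μ : Measure Plane) [IsProbabilityMeasure μ] (a b : Plane) :
    evenPlan μ a b ∈ transportPlans μ (halfDirac a b) := by
  have hm (c : Plane) : Measurable fun x : Plane => (x, c) := by fun_prop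
  have (c : Plane) : IsProbabilityMeasure (μ.map fun x => (x, c)) :=
    Measure.isProbabilityMeasure_map (hm c).aemeasurable
  refine ⟨isProbabilityMeasure_half_add _ _, ?_, ?_⟩
  · rw [evenPlan, Measure.map_smul, Measure.map_add _ _ measurable_fst,
      Measure.map_map measurable_fst (hm a), Measure.map_map measurable_fst (hm b)]
    have (c : Plane) : Prod.fst ∘ (fun x : Plane => (x, c)) = id := rfl
    rw [this, this, Measure.map_id, ← two_smul ℝ≥0∞, smul_smul,
      ENNReal.inv_mul_cancel (by norm_num) (by norm_num), one_smul]
  · rw [evenPlan, Measure.map_smul, Measure.map_add _ _ measurable_snd,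
      Measure.map_map measurable_snd (hm a), Measure.map_map measurable_snd (hm b)]
    have (c : Plane) : Prod.snd ∘ (fun x : Plane => (x, c)) = fun _ => c := rfl
    simp [this, halfDirac]

theorem lintegral_evenPlan {μ : Measure Plane} (hμ : μ ∈ P2 Plane) (a b : Plane) :
    ∫⁻ z, ‖z.1 - z.2‖ₑ ^ 2 ∂evenPlan μ a b =
      2⁻¹ * (ENNReal.ofReal (∫ x, ‖x - a‖ ^ 2 ∂μ) + ENNReal.ofReal (∫ x, ‖x - b‖ ^ 2 ∂μ)) := by
  rw [evenPlan, lintegral_smul_measure, lintegral_add_measure,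
    lintegral_map (by fun_prop) (by fun_prop), lintegral_map (by fun_prop) (by fun_prop),
    lintegral_enorm_sub_sq hμ, lintegral_enorm_sub_sq hμ, smul_eq_mul]

theorem lintegral_evenPlan_ne_top {μ : Measure Plane} (hμ : μ ∈ P2 Plane) (a b : Plane) :
    ∫⁻ z, ‖z.1 - z.2‖ₑ ^ 2 ∂evenPlan μ a b ≠ ∞ := by
  rw [lintegral_evenPlan hμ]
  exact ENNReal.mul_ne_top (by norm_num) (by simp)

theorem integrable_min_norm_sub_sq {μ : Measure Plane} (hμ : μ ∈ P2 Plane) (a b : Plane) :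
    Integrable (fun x => min (‖x - a‖ ^ 2) (‖x - b‖ ^ 2)) μ :=
  (integrable_norm_sub_sq hμ a).inf (integrable_norm_sub_sq hμ b)

/-- Every plan moves each point at least to the nearer one of the two atoms. -/
theorem integral_min_le_W2_sq {μ : Measure Plane} (hμ : μ ∈ P2 Plane) (a b : Plane) :
    ∫ x, min (‖x - a‖ ^ 2) (‖x - b‖ ^ 2) ∂μ ≤ W2 μ (halfDirac a b) ^ 2 := by
  have := hμ.1
  have h0 : ∀ x : Plane, 0 ≤ min (‖x - a‖ ^ 2) (‖x - b‖ ^ 2) := fun x => by positivity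
  rw [← ENNReal.toReal_ofReal (integral_nonneg h0)]
  refine le_W2_sq (evenPlan_mem μ a b) (lintegral_evenPlan_ne_top hμ a b) ?_
  rintro γ ⟨-, h₁, h₂⟩
  rw [ofReal_integral_eq_lintegral_ofReal (integrable_min_norm_sub_sq hμ a b) (ae_of_all _ h0),
    ← h₁, lintegral_map (by fun_prop) measurable_fst]
  have hab : ∀ᵐ z ∂γ, z.2 = a ∨ z.2 = b := by
    refine ae_of_ae_map (f := Prod.snd) (p := fun y => y = a ∨ y = b) measurable_snd.aemeasurable ?_
    rw [h₂, halfDirac]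
    refine Measure.ae_smul_measure (ae_add_measure_iff.2 ⟨?_, ?_⟩) _ <;>
    · rw [ae_dirac_eq]; simp
  refine lintegral_mono_ae ?_
  filter_upwards [hab] with z hz
  rw [enorm_sq_eq]
  refine ENNReal.ofReal_le_ofReal ?_
  rcases hz with hz | hz <;> rw [hz]
  exacts [min_le_left _ _, min_le_right _ _]

theorem W2_dirac_sq_le {μ : Measure Plane} (hμ : μ ∈ P2 Plane) (a : Plane) :
    W2 μ (Measure.dirac a) ^ 2 ≤ ∫ x, ‖x - a‖ ^ 2 ∂μ := by
  have := hμ.1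
  rw [← halfDirac_self]
  refine (W2_sq_le (evenPlan_mem μ a a) (lintegral_evenPlan_ne_top hμ a a)).trans_eq ?_
  rw [lintegral_evenPlan hμ, ← two_mul, ← mul_assoc,
    ENNReal.inv_mul_cancel (by norm_num) (by norm_num), one_mul,
    ENNReal.toReal_ofReal (integral_nonneg fun x => by positivity)]

/-- Pairing `p` with `a` and `q` with `b` is a plan. -/
theorem W2_halfDirac_sq_le (p q a b : Plane) :
    W2 (halfDirac p q) (halfDirac a b) ^ 2 ≤ 2⁻¹ * (‖p - a‖ ^ 2 + ‖q - b‖ ^ 2) := by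
  let γ : Measure (Plane × Plane) :=
    (2⁻¹ : ℝ≥0∞) • (Measure.dirac (p, a) + Measure.dirac (q, b))
  have hγ : γ ∈ transportPlans (halfDirac p q) (halfDirac a b) := by
    refine ⟨isProbabilityMeasure_half_add _ _, ?_, ?_⟩
    · rw [Measure.map_smul, Measure.map_add _ _ measurable_fst, Measure.map_dirac' measurable_fst,
        Measure.map_dirac' measurable_fst, halfDirac]
    · rw [Measure.map_smul, Measure.map_add _ _ measurable_snd, Measure.map_dirac' measurable_snd,
        Measure.map_dirac' measurable_snd, halfDirac]
  have hc : ∫⁻ z, ‖z.1 - z.2‖ₑ ^ 2 ∂γ =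
      ENNReal.ofReal (2⁻¹ * (‖p - a‖ ^ 2 + ‖q - b‖ ^ 2)) := by
    rw [lintegral_smul_measure, lintegral_add_measure, lintegral_dirac, lintegral_dirac,
      enorm_sq_eq, enorm_sq_eq, ← ENNReal.ofReal_add (by positivity) (by positivity),
      ENNReal.ofReal_mul (by norm_num), smul_eq_mul, ENNReal.ofReal_inv_of_pos (by norm_num)]
    norm_num
  refine (W2_sq_le hγ (by rw [hc]; exact ENNReal.ofReal_ne_top)).trans_eq ?_
  rw [hc, ENNReal.toReal_ofReal (by positivity)]

/-- When the pairing already sends each point to its nearer atom, its cost meets the lower bound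
`integral_min_le_W2_sq`. -/
theorem W2_halfDirac_sq {p q a b : Plane} (hp : ‖p - a‖ ^ 2 ≤ ‖p - b‖ ^ 2)
    (hq : ‖q - b‖ ^ 2 ≤ ‖q - a‖ ^ 2) :
    W2 (halfDirac p q) (halfDirac a b) ^ 2 = 2⁻¹ * (‖p - a‖ ^ 2 + ‖q - b‖ ^ 2) := by
  refine (W2_halfDirac_sq_le p q a b).antisymm ?_
  have h := integral_min_le_W2_sq (halfDirac_mem_P2 p q) a b
  rwa [integral_halfDirac, min_eq_left hp, min_eq_right hq] at h

theorem norm_sub_sq_eq (p a : Plane) : ‖p - a‖ ^ 2 = (p 0 - a 0) ^ 2 + (p 1 - a 1) ^ 2 := by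
  simp [EuclideanSpace.real_norm_sq_eq, Fin.sum_univ_two]

theorem energy_halfDirac_vertical {s : ℝ} (hs : 0 ≤ s) :
    energy (halfDirac !₂[0, s] !₂[0, -s]) = (s - 2) ^ 2 := by
  rw [energy, ν₀, ← halfDirac_self, ν₁, ν₂, W2_halfDirac_sq le_rfl le_rfl]
  -- Atoms are reordered so that the pairing is the nearest one.
  have hc : halfDirac !₂[(-1 : ℝ), -1] !₂[1, 1] = halfDirac !₂[1, 1] !₂[-1, -1] := by
    rw [halfDirac, halfDirac, add_comm]
  have hd : halfDirac !₂[(1 : ℝ), -1] !₂[-1, 1] = halfDirac !₂[-1, 1] !₂[1, -1] := by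
    rw [halfDirac, halfDirac, add_comm]
  rw [hc, hd, W2_halfDirac_sq, W2_halfDirac_sq]
  all_goals simp only [norm_sub_sq_eq, Matrix.cons_val_zero, Matrix.cons_val_one]
  · ring
  all_goals nlinarith

theorem energy_halfDirac_horizontal {s : ℝ} (hs : 0 ≤ s) :
    energy (halfDirac !₂[s, 0] !₂[-s, 0]) = (s - 2) ^ 2 := by
  rw [energy, ν₀, ← halfDirac_self, ν₁, ν₂, W2_halfDirac_sq le_rfl le_rfl]
  have hc : halfDirac !₂[(-1 : ℝ), -1] !₂[1, 1] = halfDirac !₂[1, 1] !₂[-1, -1] := by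
    rw [halfDirac, halfDirac, add_comm]
  rw [hc, W2_halfDirac_sq, W2_halfDirac_sq]
  all_goals simp only [norm_sub_sq_eq, Matrix.cons_val_zero, Matrix.cons_val_one]
  · ring
  all_goals nlinarith

/-! ### Pointwise lower bound of the energy. -/

/-- The integrand of the lower bound of the energy that drops the marginal constraints. -/
noncomputable def energyDensity (p : Plane) : ℝ :=
  -‖p - !₂[0, 0]‖ ^ 2 + min (‖p - !₂[-1, -1]‖ ^ 2) (‖p - !₂[1, 1]‖ ^ 2) +
    min (‖p - !₂[1, -1]‖ ^ 2) (‖p - !₂[-1, 1]‖ ^ 2)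

theorem le_energy {μ : Measure Plane} (hμ : μ ∈ P2 Plane) {c : ℝ}
    (hc : ∀ᵐ p ∂μ, c ≤ energyDensity p) : c ≤ energy μ := by
  have := hμ.1
  have i₀ := (integrable_norm_sub_sq hμ !₂[0, 0]).neg
  have i₁ := integrable_min_norm_sub_sq hμ !₂[-1, -1] !₂[1, 1]
  have i₂ := integrable_min_norm_sub_sq hμ !₂[1, -1] !₂[-1, 1]
  have h₀ := W2_dirac_sq_le hμ !₂[0, 0]
  have h₁ := integral_min_le_W2_sq hμ !₂[-1, -1] !₂[1, 1]
  have h₂ := integral_min_le_W2_sq hμ !₂[1, -1] !₂[-1, 1]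
  have h : c ≤ ∫ p, energyDensity p ∂μ := by
    have := integral_mono_ae (integrable_const c) ((i₀.add i₁).add i₂) hc
    rwa [integral_const, probReal_univ, one_smul] at this
  have e : ∫ p, energyDensity p ∂μ = -∫ p, ‖p - !₂[0, 0]‖ ^ 2 ∂μ +
      ∫ p, min (‖p - !₂[-1, -1]‖ ^ 2) (‖p - !₂[1, 1]‖ ^ 2) ∂μ +
      ∫ p, min (‖p - !₂[1, -1]‖ ^ 2) (‖p - !₂[-1, 1]‖ ^ 2) ∂μ := by
    rw [← integral_neg]
    exact (integral_add (i₀.add i₁) i₂).trans (congrArg (· + _) (integral_add i₀ i₁))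
  rw [energy, ν₀, ν₁, ν₂]
  linarith

theorem energyDensity_eq (p : Plane) : energyDensity p =
    p 0 ^ 2 + p 1 ^ 2 + 4 - 2 * |p 0 + p 1| - 2 * |p 0 - p 1| := by
  simp only [energyDensity, norm_sub_sq_eq, Matrix.cons_val_zero, Matrix.cons_val_one]
  rcases abs_cases (p 0 + p 1) with ⟨h, h'⟩ | ⟨h, h'⟩ <;>
  rcases abs_cases (p 0 - p 1) with ⟨k, k'⟩ | ⟨k, k'⟩ <;> rw [h, k]
  · rw [min_eq_right (by nlinarith), min_eq_left (by nlinarith)]; ring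
  · rw [min_eq_right (by nlinarith), min_eq_right (by nlinarith)]; ring
  · rw [min_eq_left (by nlinarith), min_eq_left (by nlinarith)]; ring
  · rw [min_eq_left (by nlinarith), min_eq_right (by nlinarith)]; ring

theorem energyDensity_nonneg (p : Plane) : 0 ≤ energyDensity p := by
  rw [energyDensity_eq]
  rcases abs_cases (p 0 + p 1) with ⟨h, h'⟩ | ⟨h, h'⟩ <;>
  rcases abs_cases (p 0 - p 1) with ⟨k, k'⟩ | ⟨k, k'⟩ <;> rw [h, k]
  -- In each sign case the density is the squared distance to one of `(±2, 0)`, `(0, ±2)`.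
  · nlinarith [sq_nonneg (p 0 - 2), sq_nonneg (p 1)]
  · nlinarith [sq_nonneg (p 1 - 2), sq_nonneg (p 0)]
  · nlinarith [sq_nonneg (p 1 + 2), sq_nonneg (p 0)]
  · nlinarith [sq_nonneg (p 0 + 2), sq_nonneg (p 1)]

theorem two_le_energyDensity {p : Plane} (hp : p ∈ diagonals) : 2 ≤ energyDensity p := by
  rw [energyDensity_eq]
  rcases abs_eq_abs.1 (show |p 0| = |p 1| from hp) with h | h <;> rw [h]
  · rw [sub_self, abs_zero, ← two_mul (p 1), abs_mul, abs_two]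
    nlinarith [sq_nonneg (|p 1| - 1), sq_abs (p 1)]
  · rw [neg_add_cancel, abs_zero, show -p 1 - p 1 = -(2 * p 1) by ring, abs_neg, abs_mul, abs_two]
    nlinarith [sq_nonneg (|p 1| - 1), sq_abs (p 1)]

theorem energy_nonneg {μ : Measure Plane} (hμ : μ ∈ P2 Plane) : 0 ≤ energy μ :=
  le_energy hμ (ae_of_all _ energyDensity_nonneg)

theorem isMinimizer_of_energy_eq_zero {μ : Measure Plane} (hμ : μ ∈ P2 Plane)
    (h : energy μ = 0) : IsMinimizer μ :=
  ⟨hμ, fun _ hρ => h.trans_le (energy_nonneg hρ)⟩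

theorem isMinimizer_vertical : IsMinimizer (halfDirac !₂[0, 2] !₂[0, -2]) :=
  isMinimizer_of_energy_eq_zero (halfDirac_mem_P2 _ _)
    (by rw [energy_halfDirac_vertical (by norm_num)]; norm_num)

theorem isMinimizer_horizontal : IsMinimizer (halfDirac !₂[2, 0] !₂[-2, 0]) :=
  isMinimizer_of_energy_eq_zero (halfDirac_mem_P2 _ _)
    (by rw [energy_halfDirac_horizontal (by norm_num)]; norm_num)

theorem vertical_ne_horizontal :
    halfDirac !₂[(0 : ℝ), 2] !₂[0, -2] ≠ halfDirac !₂[2, 0] !₂[-2, 0] := by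
  intro h
  -- The second moment in `x` is `0` for one and `4` for the other.
  have := congrArg (fun μ : Measure Plane => ∫ p, p 0 ^ 2 ∂μ) h
  simp only [integral_halfDirac] at this
  norm_num at this

/-! ### Fold-invariant measures. -/

theorem isClosed_diagonals : IsClosed diagonals :=
  isClosed_eq (by fun_prop) (by fun_prop)

/-- The reflection swaps `|x|` and `|y|`, so no point lands in the folded region; an invariant
measure gives it no mass. -/
theorem foldS_preimage : foldS ⁻¹' {p | |p 0| < |p 1|} = ∅ := by
  ext p
  by_cases h : |p 0| < |p 1|
  · simp [foldS, h, h.le]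
  · simp [foldS, h]

theorem foldT_preimage : foldT ⁻¹' {p | |p 1| < |p 0|} = ∅ := by
  ext p
  by_cases h : |p 1| < |p 0|
  · simp [foldT, h, h.le]
  · simp [foldT, h]

theorem support_subset_diagonals {μ : Measure Plane} (hS : μ.map foldS = μ)
    (hT : μ.map foldT = μ) : μ.support ⊆ diagonals := by
  have h₁ : μ {p | |p 0| < |p 1|} = 0 := by
    rw [← hS, Measure.map_apply measurable_foldS
      (measurableSet_lt (by fun_prop) (by fun_prop)), foldS_preimage, measure_empty]
  have h₂ : μ {p | |p 1| < |p 0|} = 0 := by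
    rw [← hT, Measure.map_apply measurable_foldT
      (measurableSet_lt (by fun_prop) (by fun_prop)), foldT_preimage, measure_empty]
  refine Measure.support_subset_of_isClosed isClosed_diagonals ?_
  refine measure_mono_null (fun p hp => ?_) (measure_union_null h₁ h₂)
  exact lt_or_gt_of_ne hp

theorem two_le_energy {μ : Measure Plane} (hμ : μ ∈ P2 Plane) (h : μ.support ⊆ diagonals) :
    2 ≤ energy μ := by
  refine le_energy hμ ?_
  filter_upwards [Measure.support_mem_ae (μ := μ)] with p hp
  exact two_le_energyDensity (h hp)

theorem energy_η : energy η = 1 := by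
  rw [η, energy_halfDirac_vertical zero_le_one]
  norm_num

end SignedBarycenter

theorem mainTheorem7 :
    ((∃ μ : Measure SignedBarycenter.Plane, SignedBarycenter.IsMinimizer μ) ∧
      ¬ ∃! μ : Measure SignedBarycenter.Plane, SignedBarycenter.IsMinimizer μ) ∧
    (∀ μ ∈ SignedBarycenter.P2 SignedBarycenter.Plane,
      μ.map SignedBarycenter.foldS = μ → μ.map SignedBarycenter.foldT = μ →
        μ.support ⊆ SignedBarycenter.diagonals) ∧
    (∀ μ ∈ SignedBarycenter.P2 SignedBarycenter.Plane,
      μ.support ⊆ SignedBarycenter.diagonals → 2 ≤ SignedBarycenter.energy μ) ∧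
    (SignedBarycenter.η ∈ SignedBarycenter.P2 SignedBarycenter.Plane ∧
      SignedBarycenter.energy SignedBarycenter.η = 1) := by
  open SignedBarycenter in
  exact ⟨⟨⟨_, isMinimizer_vertical⟩, fun h =>
      vertical_ne_horizontal (h.unique isMinimizer_vertical isMinimizer_horizontal)⟩,
    fun _ _ hS hT => support_subset_diagonals hS hT, fun _ hμ h => two_le_energy hμ h,
    halfDirac_mem_P2 _ _, energy_η⟩
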